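/- Let $n \ge 1$, let $V$ be a finite-dimensional real inner product space (for instance $V=\mathbb{R}$ or $V=\mathbb{R}^N$), and let $u \in L^2(\mathbb{R}^n,V)$ with $\Delta^{n/4}u \in L^2(\mathbb{R}^n,V)$, i.e. for every $e\in V$ the function $\xi\mapsto (2\pi|\xi|)^{n/2}\,\langle u,e\rangle^{\wedge}(\xi)$ belongs to $L^2(\mathbb{R}^n,\mathbb{C})$, where $f^\wedge$ denotes the Fourier transform of $f\in L^2(\mathbb{R}^n)$. Let $D\subset\mathbb{R}^n$ be a bounded open set with $\partial D\in C^\infty$, i.e. every $p\in\partial D$ has an open neighbourhood $U$ on which there is a smooth function $\rho:U\to\mathbb{R}$ with $d\rho\neq 0$ on $U$ and $D\cap U=\{x\in U:\rho(x)<0\}$. Let $\alpha\in(0,1]$, and suppose that for some $\Lambda\ge 1$ and $K\ge 0$, for every $x_0\in\mathbb{R}^n$ and $r>0$ with $B_{\Lambda r}(x_0)\subset D$, \[ |u(x)-u(y)|\le K\left(\frac{|x-y|^\alpha}{r^\alpha}+|x-y|^\alpha\right)\qquad\text{for almost all } x,y\in B_r(x_0). \] For $\gamma>0$ write $B_\gamma(D)=\{x\in\mathbb{R}^n:\operatorname{dist}(x,D)<\gamma\}$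 (with $B_\gamma(\emptyset)=\emptyset$), and suppose that for some $\gamma>0$ we have $u\in C^0(B_\gamma(D)\setminus D)$, i.e. there is a continuous function $g$ on $B_\gamma(D)\setminus D$ with $u=g$ almost everywhere on $B_\gamma(D)\setminus D$. Then $u$ is, up to modification on a null set, continuous on $B_\gamma(D)$ and locally $\alpha$-H\"older continuous in $D$: there is $w:\mathbb{R}^n\to V$ with $w=u$ almost everywhere such that $w$ is continuous on $B_\gamma(D)$; $w=g$ on $B_\gamma(D)\setminus D$; $w\in C^{0,\alpha}(B_r(x_0))$ for every ball $B_r(x_0)$, $r>0$, with $B_{\Lambda r}(x_0)\subset D$; and $w\in C^{0,\alpha}(S)$ for every compact $S\subset D$. -/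

import Mathlib

open MeasureTheory Set Metric
open scoped FourierTransform ContDiff NNReal

noncomputable section

/-- Euclidean space `ℝⁿ`. -/
abbrev EucSpace (n : ℕ) : Type := EuclideanSpace ℝ (Fin n)

/-- `v = Δ^{s/2} f` for `f, v ∈ L²(ℝⁿ)`: on the Fourier side (with the convention
`f^(ξ) = ∫ f(x) e^{-2πi x·ξ} dx`) one has `v^(ξ) = (2π|ξ|)^s f^(ξ)` for almost every `ξ`.
For `s = 2` this is `-Δ`; unimodular constants in the normalisation do not affect whether such a
`v ∈ L²` exists. -/
def IsFracLaplacian {n : ℕ} (s : ℝ) (f v : Lp ℂ 2 (volume : Measure (EucSpace n))) : Prop :=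
  ⇑(𝓕 v : Lp ℂ 2 (volume : Measure (EucSpace n))) =ᵐ[volume] fun ξ =>
    (((2 * Real.pi * ‖ξ‖) ^ s : ℝ) : ℂ) * (𝓕 f : Lp ℂ 2 (volume : Measure (EucSpace n))) ξ

/-- `Δ^{s/2} f ∈ L²(ℝⁿ)` for a real-valued `f ∈ L²(ℝⁿ)`. -/
def FracLaplacianMemL2 {n : ℕ} (s : ℝ) (f : EucSpace n → ℝ) : Prop :=
  ∃ hf : MemLp (fun x => (f x : ℂ)) 2 volume,
    ∃ v : Lp ℂ 2 (volume : Measure (EucSpace n)), IsFracLaplacian s (hf.toLp _) v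

/-- The fractional Sobolev space `H^s(ℝⁿ, V)` of all `u ∈ L²` with `Δ^{s/2} u ∈ L²`; for
`V`-valued functions the second condition is read through the scalar functions `⟨u, e⟩`. -/
def MemFracSobolev {n : ℕ} {V : Type*} [NormedAddCommGroup V] [InnerProductSpace ℝ V]
    (s : ℝ) (u : EucSpace n → V) : Prop :=
  MemLp u 2 volume ∧ ∀ e : V, FracLaplacianMemL2 s (fun x => inner ℝ (u x) e)

/-- `∂D ∈ C^∞`: near each boundary point, `D` is the sublevel set `{ρ < 0}` of a smooth function
`ρ` without critical points (so `D` lies locally on one side of the smooth hypersurface `∂D`). -/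
def HasSmoothBoundary {n : ℕ} (D : Set (EucSpace n)) : Prop :=
  ∀ p ∈ frontier D, ∃ U : Set (EucSpace n), IsOpen U ∧ p ∈ U ∧
    ∃ ρ : EucSpace n → ℝ, ContDiffOn ℝ ∞ ρ U ∧ (∀ x ∈ U, fderiv ℝ ρ x ≠ 0) ∧
      D ∩ U = {x ∈ U | ρ x < 0}

/-- The scaled interior Hölder estimate: for each ball `B_r` with `B_{Λr} ⊆ D` (concentric),
`|u(x) - u(y)| ≤ K (|x-y|^α / r^α + |x-y|^α)` for almost all `x, y ∈ B_r`. -/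
def InteriorHolderEstimate {n : ℕ} {V : Type*} [NormedAddCommGroup V]
    (u : EucSpace n → V) (D : Set (EucSpace n)) (Λ K α : ℝ) : Prop :=
  ∀ (x₀ : EucSpace n) (r : ℝ), 0 < r → ball x₀ (Λ * r) ⊆ D →
    ∀ᵐ x ∂(volume.restrict (ball x₀ r)), ∀ᵐ y ∂(volume.restrict (ball x₀ r)),
      ‖u x - u y‖ ≤ K * (‖x - y‖ ^ α / r ^ α + ‖x - y‖ ^ α)

end

/-! Inside `D` the interior estimate is a modulus of continuity on small balls, so `u` has a
continuous representative `w` there, and outside `D` the function `g` is one. Only the matching at a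
point `p ∈ ∂D` is at stake. The critical space `H^{n/2}` misses the embedding into continuous
functions, but its elements have vanishing mean oscillation: on every ball of small radius,
uniformly in the centre, `u` is close in quadratic mean to a constant.

Let `x ∈ D` be near `p`, let `q` be a nearest boundary point and `d = |x - q|`. The ball of radius
`2d` about `x` contains two balls of radius comparable to `d`. One is a ball about `x` of radius
`δd/Λ`, on which the scaled estimate keeps `w` near `w x`. The other is a ball outside `D`, supplied
by the smooth boundary, on which `u = g` a.e. and `g` is near `g p`. Each fills a fixed fraction of
the large ball, so small oscillation puts a value of `u` from each near the same constant
(`exists_enorm_sub_sq_lt`). Hence `w x` is near `g p`; this is `tendsto_nhdsWithin_frontier`.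

Vanishing mean oscillation comes from splitting the Fourier transform at `|ξ| = 1/r`. The part with
`|ξ| ≥ 1/r` has squared `L²` norm `o(r^n)`. The rest is Lipschitz with constant `o(1/r)`, by
Cauchy–Schwarz against `|ξ|^{n/2} û ∈ L²`, so it varies by `o(1)` on a ball of radius `r`. -/

/-! ### Fourier inversion and the Lipschitz bound -/

/-- On `L¹ ∩ L²` the inverse Fourier transform of `L²` is given by the usual integral. -/
theorem fourierInv_Lp_ae_eq {E : Type*} [NormedAddCommGroup E] [InnerProductSpace ℝ E]
    [FiniteDimensional ℝ E] [MeasurableSpace E] [BorelSpace E]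
    (h : Lp ℂ 2 (volume : Measure E)) (hi : Integrable h volume) :
    ⇑(𝓕⁻ h : Lp ℂ 2 (volume : Measure E)) =ᵐ[volume] 𝓕⁻ (⇑h : E → ℂ) := by
  have B : Continuous fun p : E × E => (- innerₗ E) p.1 p.2 := continuous_inner.neg
  have hcont : Continuous (𝓕⁻ (⇑h : E → ℂ)) :=
    VectorFourier.fourierIntegral_continuous Real.continuous_fourierChar B hi
  -- Both sides are tested against smooth compactly supported functions. The transform moves onto
  -- the test function by duality of tempered distributions on the `L²` side, and by Fubini on the
  -- `L¹` side.
  refine ae_eq_of_integral_contDiff_smul_eq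
    ((Lp.memLp (𝓕⁻ h)).locallyIntegrable (by norm_num)) hcont.locallyIntegrable ?_
  intro φ φ_smooth φ_cpt
  have h₁ : HasCompactSupport (Complex.ofRealCLM ∘ φ) := φ_cpt.comp_left rfl
  have h₂ : ContDiff ℝ ∞ (Complex.ofRealCLM ∘ φ) := by fun_prop
  set Φ := h₁.toSchwartzMap h₂ with hΦ
  calc ∫ x, φ x • (𝓕⁻ h : Lp ℂ 2 (volume : Measure E)) x
      = Lp.toTemperedDistribution (𝓕⁻ h) Φ := by
        simp [hΦ]
    _ = ∫ x, (𝓕⁻ Φ) x • h x := by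
        rw [← Lp.fourierInv_toTemperedDistribution_eq, TemperedDistribution.fourierInv_apply,
          Lp.toTemperedDistribution_apply]
    _ = ∫ x, Φ x • 𝓕⁻ (⇑h : E → ℂ) x := by
        have := VectorFourier.integral_fourierIntegral_smul_eq_flip (L := - innerₗ E)
          Real.continuous_fourierChar B (Φ.integrable (μ := volume)) hi
        have e : (- innerₗ E).flip = - innerₗ E := by
          ext x y; simp [real_inner_comm]
        rw [e] at this
        rw [SchwartzMap.fourierInv_coe]
        exact this
    _ = ∫ x, φ x • 𝓕⁻ (⇑h : E → ℂ) x := by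
        simp [hΦ]

theorem norm_cexp_mul_I_sub_le (a b : ℝ) :
    ‖Complex.exp (a * Complex.I) - Complex.exp (b * Complex.I)‖ ≤ |a - b| := by
  have h : Complex.exp (a * Complex.I) - Complex.exp (b * Complex.I)
      = Complex.exp (b * Complex.I) * (Complex.exp (Complex.I * ((a - b : ℝ) : ℂ)) - 1) := by
    rw [mul_sub, ← Complex.exp_add]
    push_cast
    ring_nf
  rw [h, norm_mul, Complex.norm_exp_ofReal_mul_I, one_mul]
  exact Real.norm_exp_I_mul_ofReal_sub_one_le

/-- The inverse Fourier transform of `h` is Lipschitz, with constant controlled by the first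
absolute moment of `h`. -/
theorem enorm_fourierInv_sub_le {E : Type*} [NormedAddCommGroup E] [InnerProductSpace ℝ E]
    [FiniteDimensional ℝ E] [MeasurableSpace E] [BorelSpace E]
    {h : E → ℂ} (hi : Integrable h volume) (x y : E) :
    ‖𝓕⁻ h x - 𝓕⁻ h y‖ₑ ≤
      ENNReal.ofReal (2 * Real.pi) * ‖x - y‖ₑ * ∫⁻ ξ, ‖ξ‖ₑ * ‖h ξ‖ₑ := by
  have hint (z : E) : Integrable
      (fun v : E => Complex.exp (↑(2 * Real.pi * inner ℝ v z) * Complex.I) • h v) := by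
    refine Integrable.bdd_mul hi (c := 1) (Continuous.aestronglyMeasurable (by fun_prop)) ?_
    exact ae_of_all _ fun v => (Complex.norm_exp_ofReal_mul_I _).le
  rw [Real.fourierInv_eq', Real.fourierInv_eq', ← integral_sub (hint x) (hint y),
    ← lintegral_const_mul' _ _ (by finiteness)]
  refine (enorm_integral_le_lintegral_enorm _).trans (lintegral_mono fun ξ => ?_)
  rw [← sub_smul, smul_eq_mul, enorm_mul, ← mul_assoc]
  gcongr
  rw [← ofReal_norm, ← ofReal_norm, ← ofReal_norm, ← ENNReal.ofReal_mul (by positivity),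
    ← ENNReal.ofReal_mul (by positivity)]
  apply ENNReal.ofReal_le_ofReal
  refine (norm_cexp_mul_I_sub_le _ _).trans ?_
  rw [← mul_sub, ← inner_sub_right, abs_mul, abs_of_pos (by positivity),
    mul_assoc (2 * Real.pi) ‖x - y‖]
  gcongr
  exact (abs_real_inner_le_norm ξ (x - y)).trans_eq (mul_comm _ _)

/-! ### High- and low-frequency estimates -/

/-- In polar coordinates the Jacobian `y^{n-1}` turns the weight `y^{2-n}` into `y`, which is
integrable at `0`. This weight is the square of the factor `|ξ|^{1-n/2}` in the Cauchy–Schwarz bound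
for low frequencies. -/
theorem lintegral_ball_norm_rpow_two_sub_le {n : ℕ} (hn : 0 < n) :
    ∃ C : ℝ≥0, ∀ R : ℝ, 0 < R →
      ∫⁻ ξ in ball (0 : EucSpace n) R, ENNReal.ofReal (‖ξ‖ ^ (2 - n : ℝ))
        ≤ C * ENNReal.ofReal (R ^ 2) := by
  have : Nonempty (Fin n) := ⟨⟨0, hn⟩⟩
  refine ⟨n * (volume (ball (0 : EucSpace n) 1)).toNNReal, fun R hR => ?_⟩
  set f : ℝ → ℝ := (Iio R).indicator fun y => y ^ (2 - n : ℝ) with hf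
  have hfun (y : ℝ) (hy : y ∈ Ioi (0 : ℝ)) :
      y ^ (n - 1) • f y = (Iio R).indicator (fun y => y) y := by
    rw [mem_Ioi] at hy
    by_cases hyR : y ∈ Iio R
    · simp only [hf, indicator_of_mem hyR, smul_eq_mul]
      rw [← Real.rpow_natCast, ← Real.rpow_add hy]
      push_cast [Nat.cast_sub (Nat.one_le_iff_ne_zero.2 hn.ne')]
      ring_nf
      simp
    · simp [hf, indicator_of_notMem hyR]
  have hI : IntegrableOn (fun y : ℝ => (Iio R).indicator (fun y => y) y) (Ioi 0) := by
    rw [IntegrableOn, integrable_indicator_iff measurableSet_Iio, IntegrableOn,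
      Measure.restrict_restrict measurableSet_Iio, Iio_inter_Ioi]
    exact (continuous_id.integrableOn_Icc (a := 0) (b := R)).mono_set Ioo_subset_Icc_self
  have hint : Integrable (fun ξ : EucSpace n => f ‖ξ‖) := by
    rw [integrable_fun_norm_addHaar (E := EucSpace n) volume, finrank_euclideanSpace_fin]
    exact hI.congr_fun (fun y hy => (hfun y hy).symm) measurableSet_Ioi
  have hnn : 0 ≤ fun ξ : EucSpace n => f ‖ξ‖ := fun ξ =>
    indicator_apply_nonneg fun _ => by positivity
  have hval : ∫ y in Ioi (0 : ℝ), y ^ (n - 1) • f y = R ^ 2 / 2 := by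
    rw [setIntegral_congr_fun measurableSet_Ioi hfun, integral_indicator measurableSet_Iio,
      Measure.restrict_restrict measurableSet_Iio, Iio_inter_Ioi, ← integral_Ioc_eq_integral_Ioo,
      ← intervalIntegral.integral_of_le hR.le]
    simp
  calc ∫⁻ ξ in ball (0 : EucSpace n) R, ENNReal.ofReal (‖ξ‖ ^ (2 - n : ℝ))
      = ∫⁻ ξ : EucSpace n, ENNReal.ofReal (f ‖ξ‖) := by
        rw [← lintegral_indicator measurableSet_ball]
        refine lintegral_congr fun ξ => ?_
        by_cases h : ‖ξ‖ < R
        · rw [indicator_of_mem (by simpa using h), hf, indicator_of_mem (by simpa using h)]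
        · rw [indicator_of_notMem (by simpa using h), hf, indicator_of_notMem (by simpa using h),
            ENNReal.ofReal_zero]
    _ = ENNReal.ofReal (n * (volume.real (ball (0 : EucSpace n) 1) * (R ^ 2 / 2))) := by
        rw [← ofReal_integral_eq_lintegral_ofReal hint (ae_of_all _ hnn),
          integral_fun_norm_addHaar, finrank_euclideanSpace_fin, hval, nsmul_eq_mul, smul_eq_mul]
    _ ≤ ENNReal.ofReal (n * volume.real (ball (0 : EucSpace n) 1) * R ^ 2) := by
        apply ENNReal.ofReal_le_ofReal
        rw [mul_assoc]
        gcongr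
        nlinarith
    _ = _ := by
        rw [ENNReal.ofReal_mul (by positivity), ENNReal.ofReal_mul (by positivity), measureReal_def,
          ENNReal.ofReal_toReal measure_ball_lt_top.ne, ENNReal.coe_mul,
          ENNReal.coe_toNNReal measure_ball_lt_top.ne]
        simp

theorem sq_lintegral_mul_le {α : Type*} [MeasurableSpace α] {μ : Measure α}
    {f g : α → ENNReal} (hf : AEMeasurable f μ) (hg : AEMeasurable g μ) :
    (∫⁻ x, f x * g x ∂μ) ^ 2 ≤ (∫⁻ x, f x ^ 2 ∂μ) * ∫⁻ x, g x ^ 2 ∂μ := by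
  have := ENNReal.lintegral_mul_le_Lp_mul_Lq μ Real.HolderConjugate.two_two hf hg
  calc _ ≤ ((∫⁻ x, f x ^ (2 : ℝ) ∂μ) ^ (1 / (2 : ℝ)) *
          (∫⁻ x, g x ^ (2 : ℝ) ∂μ) ^ (1 / (2 : ℝ))) ^ 2 := by
        gcongr; exact this
    _ = _ := by
        rw [mul_pow, ← ENNReal.rpow_natCast, ← ENNReal.rpow_natCast, ← ENNReal.rpow_mul,
          ← ENNReal.rpow_mul]
        norm_num

theorem lintegral_enorm_sq_lt_top {α : Type*} [MeasurableSpace α] {μ : Measure α}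
    {v : α → ℂ} (hv : MemLp v 2 μ) : ∫⁻ x, ‖v x‖ₑ ^ 2 ∂μ < ⊤ := by
  have := lintegral_rpow_enorm_lt_top_of_eLpNorm_lt_top (by norm_num) (by norm_num) hv.2
  simpa using this

theorem exists_lintegral_compl_ball_le {n : ℕ} {v : EucSpace n → ℂ} (hv : MemLp v 2 volume)
    {ε : ENNReal} (hε : ε ≠ 0) :
    ∃ M : ℝ, 0 < M ∧ ∫⁻ ξ in (ball (0 : EucSpace n) M)ᶜ, ‖v ξ‖ₑ ^ 2 ≤ ε := by
  have hfin := lintegral_enorm_sq_lt_top hv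
  have key := tendsto_measure_iInter_atTop
    (μ := volume.withDensity fun ξ => ‖v ξ‖ₑ ^ 2)
    (s := fun k : ℕ => (ball (0 : EucSpace n) k)ᶜ)
    (fun k => measurableSet_ball.compl.nullMeasurableSet)
    (fun i j hij => compl_subset_compl.2 (ball_subset_ball (by exact_mod_cast hij)))
    ⟨0, ((measure_mono (subset_univ _)).trans_lt (by simpa using hfin)).ne⟩
  rw [← compl_iUnion, iUnion_ball_nat, compl_univ, measure_empty] at key
  obtain ⟨k, hk, hk0⟩ := ((key.eventually_le_const (pos_iff_ne_zero.2 hε)).and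
    (Filter.eventually_gt_atTop 0)).exists
  refine ⟨k, by exact_mod_cast hk0, ?_⟩
  rwa [Function.comp_apply, withDensity_apply _ measurableSet_ball.compl] at hk


/-- Where `|ξ| ≥ 1/r` one has `1 ≤ (2πr|ξ|)^n`, hence `|a|² ≤ r^n |v|²`, and the tail of `|v|²`
tends to zero. -/
theorem exists_lintegral_compl_ball_inv_le {n : ℕ} {a v : EucSpace n → ℂ} (hv : MemLp v 2 volume)
    (hav : v =ᵐ[volume] fun ξ => (((2 * Real.pi * ‖ξ‖) ^ ((n : ℝ) / 2) : ℝ) : ℂ) * a ξ)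
    {ε : ENNReal} (hε : ε ≠ 0) :
    ∃ r₀ : ℝ, 0 < r₀ ∧ ∀ r : ℝ, 0 < r → r < r₀ →
      ∫⁻ ξ in (ball (0 : EucSpace n) r⁻¹)ᶜ, ‖a ξ‖ₑ ^ 2 ≤ ε * ENNReal.ofReal (r ^ n) := by
  obtain ⟨M, hM, hT⟩ := exists_lintegral_compl_ball_le hv hε
  refine ⟨M⁻¹, by positivity, fun r hr hrM => ?_⟩
  have hMr : M ≤ r⁻¹ := (le_inv_comm₀ hr hM).1 hrM.le
  calc ∫⁻ ξ in (ball (0 : EucSpace n) r⁻¹)ᶜ, ‖a ξ‖ₑ ^ 2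
      ≤ ∫⁻ ξ in (ball (0 : EucSpace n) r⁻¹)ᶜ, ENNReal.ofReal (r ^ n) * ‖v ξ‖ₑ ^ 2 := by
        refine setLIntegral_mono_ae' measurableSet_ball.compl ?_
        filter_upwards [hav] with ξ hξ hmem
        have hξr : r⁻¹ ≤ ‖ξ‖ := by simpa using hmem
        rw [hξ, ← ofReal_norm, ← ofReal_norm, ← ENNReal.ofReal_pow (norm_nonneg _),
          ← ENNReal.ofReal_pow (norm_nonneg _), ← ENNReal.ofReal_mul (by positivity)]
        apply ENNReal.ofReal_le_ofReal
        rw [norm_mul, Complex.norm_real, Real.norm_of_nonneg (by positivity), mul_pow,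
          ← Real.rpow_natCast (_ ^ ((n : ℝ) / 2)) 2, ← Real.rpow_mul (by positivity), ← mul_assoc]
        push_cast
        rw [div_mul_cancel₀ _ two_ne_zero, Real.rpow_natCast, ← mul_pow]
        refine le_mul_of_one_le_left (by positivity) (one_le_pow₀ ?_)
        have h1 : 1 ≤ r * ‖ξ‖ := by
          have := mul_le_mul_of_nonneg_left hξr hr.le
          rwa [mul_inv_cancel₀ hr.ne'] at this
        nlinarith [Real.pi_gt_three]
    _ = ENNReal.ofReal (r ^ n) * ∫⁻ ξ in (ball (0 : EucSpace n) r⁻¹)ᶜ, ‖v ξ‖ₑ ^ 2 :=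
        lintegral_const_mul' _ _ (by finiteness)
    _ ≤ ENNReal.ofReal (r ^ n) * ε := by
        gcongr
        exact (lintegral_mono_set (compl_subset_compl.2 (ball_subset_ball hMr))).trans hT
    _ = _ := mul_comm _ _

/-- Frequencies below a fixed `M` contribute a constant, which the factor `r` kills. Between `M` and
`1/r`, Cauchy–Schwarz gives `1/r` times the small `L²` tail of `v`. -/
theorem exists_mul_lintegral_ball_inv_le {n : ℕ} (hn : 0 < n) {a v : EucSpace n → ℂ}
    (ha : MemLp a 2 volume) (hv : MemLp v 2 volume)
    (hav : v =ᵐ[volume] fun ξ => (((2 * Real.pi * ‖ξ‖) ^ ((n : ℝ) / 2) : ℝ) : ℂ) * a ξ)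
    {ε : ℝ≥0} (hε : ε ≠ 0) :
    ∃ r₀ : ℝ, 0 < r₀ ∧ ∀ r : ℝ, 0 < r → r < r₀ →
      ENNReal.ofReal r * ∫⁻ ξ in ball (0 : EucSpace n) r⁻¹, ‖ξ‖ₑ * ‖a ξ‖ₑ ≤ 2 * ε := by
  obtain ⟨C, hC⟩ := lintegral_ball_norm_rpow_two_sub_le hn
  -- The tail is made small enough to absorb the constant `C`; the `+ 1` keeps the denominator
  -- nonzero.
  obtain ⟨M, hM, hT⟩ := exists_lintegral_compl_ball_le hv
    (ε := ((ε ^ 2 / (C + 1) : ℝ≥0) : ENNReal)) (by simpa using hε)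
  have hlow : ∫⁻ ξ in ball (0 : EucSpace n) M, ‖ξ‖ₑ * ‖a ξ‖ₑ ≠ ⊤ := by
    have hfin : IsFiniteMeasure (volume.restrict (ball (0 : EucSpace n) M)) :=
      ⟨by simpa using measure_ball_lt_top⟩
    have h1 : Integrable a (volume.restrict (ball (0 : EucSpace n) M)) :=
      (ha.restrict _).integrable (by norm_num)
    refine ne_top_of_le_ne_top (ENNReal.mul_ne_top ENNReal.ofReal_ne_top h1.2.ne)
      ((setLIntegral_mono' measurableSet_ball fun ξ hξ => ?_).trans_eq
        (lintegral_const_mul' (ENNReal.ofReal M) _ (by finiteness)))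
    gcongr
    rw [← ofReal_norm]
    exact ENNReal.ofReal_le_ofReal (by simpa using (mem_ball.1 hξ).le)
  lift (∫⁻ ξ in ball (0 : EucSpace n) M, ‖ξ‖ₑ * ‖a ξ‖ₑ) to ℝ≥0 using hlow with A hA
  refine ⟨ε / (A + 1), by positivity, fun r hr hr₀ => ?_⟩
  have hsub : ball (0 : EucSpace n) r⁻¹ ⊆ ball 0 M ∪ (ball 0 r⁻¹ \ ball 0 M) := by
    rw [union_sdiff_self]; exact subset_union_right
  have hhigh : ENNReal.ofReal r * ∫⁻ ξ in ball (0 : EucSpace n) r⁻¹ \ ball 0 M, ‖ξ‖ₑ * ‖a ξ‖ₑ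
      ≤ ε := by
    rw [← ENNReal.pow_le_pow_left_iff two_ne_zero, mul_pow]
    -- Since `(2π)^{n/2} ≥ 1`, one has `|ξ||a| ≤ |ξ|^{1-n/2}|v|` away from the origin.
    have hpt : ∫⁻ ξ in ball (0 : EucSpace n) r⁻¹ \ ball 0 M, ‖ξ‖ₑ * ‖a ξ‖ₑ ≤
        ∫⁻ ξ in ball (0 : EucSpace n) r⁻¹ \ ball 0 M,
          ENNReal.ofReal (‖ξ‖ ^ (1 - n / 2 : ℝ)) * ‖v ξ‖ₑ := by
      refine setLIntegral_mono_ae' (measurableSet_ball.diff measurableSet_ball) ?_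
      filter_upwards [hav] with ξ hξ hmem
      have hξ0 : 0 < ‖ξ‖ := hM.trans_le (by simpa using hmem.2)
      rw [hξ, ← ofReal_norm, ← ofReal_norm, ← ofReal_norm, ← ENNReal.ofReal_mul (by positivity),
        ← ENNReal.ofReal_mul (by positivity)]
      apply ENNReal.ofReal_le_ofReal
      rw [norm_mul, Complex.norm_real, Real.norm_of_nonneg (by positivity), ← mul_assoc,
        Real.mul_rpow (by positivity) (by positivity), mul_left_comm, ← Real.rpow_add hξ0,
        sub_add_cancel, Real.rpow_one, mul_assoc]
      refine le_mul_of_one_le_left (by positivity) (Real.one_le_rpow ?_ (by positivity))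
      linarith [Real.pi_gt_three]
    calc ENNReal.ofReal r ^ 2 * (∫⁻ ξ in ball (0 : EucSpace n) r⁻¹ \ ball 0 M, ‖ξ‖ₑ * ‖a ξ‖ₑ) ^ 2
        ≤ ENNReal.ofReal r ^ 2 * ((∫⁻ ξ in ball (0 : EucSpace n) r⁻¹ \ ball 0 M,
            ENNReal.ofReal (‖ξ‖ ^ (1 - n / 2 : ℝ)) ^ 2) *
            ∫⁻ ξ in ball (0 : EucSpace n) r⁻¹ \ ball 0 M, ‖v ξ‖ₑ ^ 2) := by
          gcongr
          refine (pow_le_pow_left₀ zero_le hpt 2).trans (sq_lintegral_mul_le ?_ ?_)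
          · exact (by fun_prop : Measurable fun ξ : EucSpace n =>
              ENNReal.ofReal (‖ξ‖ ^ (1 - n / 2 : ℝ))).aemeasurable
          · exact hv.1.restrict.enorm
      _ ≤ ENNReal.ofReal r ^ 2 * ((C * ENNReal.ofReal (r⁻¹ ^ 2)) *
            ((ε ^ 2 / (C + 1) : ℝ≥0) : ENNReal)) := by
          gcongr
          · refine le_trans ?_ (hC r⁻¹ (by positivity))
            refine (lintegral_mono_set sdiff_subset).trans_eq (lintegral_congr fun ξ => ?_)
            rw [← ENNReal.ofReal_pow (by positivity), ← Real.rpow_natCast _ 2,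
              ← Real.rpow_mul (by positivity)]
            congr 2
            push_cast
            ring
          · exact (lintegral_mono_set fun ξ hξ => hξ.2).trans hT
      _ = (C * (ε ^ 2 / (C + 1)) : ℝ≥0) := by
          have : ENNReal.ofReal r ^ 2 * ENNReal.ofReal (r⁻¹ ^ 2) = 1 := by
            rw [← ENNReal.ofReal_pow hr.le, ← ENNReal.ofReal_mul (by positivity), ← mul_pow,
              mul_inv_cancel₀ hr.ne']
            simp
          rw [mul_assoc, mul_left_comm, ← mul_assoc _ (ENNReal.ofReal (r⁻¹ ^ 2)), this, one_mul,
            ← ENNReal.coe_mul]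
      _ ≤ (ε : ENNReal) ^ 2 := by
          rw [← ENNReal.coe_pow, ENNReal.coe_le_coe, mul_div_left_comm]
          refine mul_le_of_le_one_right (by positivity) (div_le_one_of_le₀ ?_ (by positivity))
          exact le_self_add
  calc ENNReal.ofReal r * ∫⁻ ξ in ball (0 : EucSpace n) r⁻¹, ‖ξ‖ₑ * ‖a ξ‖ₑ
      ≤ ENNReal.ofReal r * (A + ∫⁻ ξ in ball (0 : EucSpace n) r⁻¹ \ ball 0 M, ‖ξ‖ₑ * ‖a ξ‖ₑ) := by
        gcongr
        rw [hA]
        exact (lintegral_mono_set hsub).trans (lintegral_union_le _ _ _)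
    _ ≤ ε + ε := by
        rw [mul_add]
        gcongr
        rw [← ENNReal.ofReal_coe_nnreal, ← ENNReal.ofReal_mul hr.le, ← ENNReal.ofReal_coe_nnreal]
        apply ENNReal.ofReal_le_ofReal
        rw [lt_div_iff₀ (by positivity)] at hr₀
        nlinarith
    _ = _ := (two_mul _).symm

/-! ### Vanishing mean oscillation -/

theorem lintegral_enorm_sq_eq {α : Type*} [MeasurableSpace α] {μ : Measure α}
    (g : Lp ℂ 2 μ) : ∫⁻ x, ‖g x‖ₑ ^ 2 ∂μ = ‖g‖ₑ ^ 2 := by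
  rw [Lp.enorm_def, eLpNorm_eq_lintegral_rpow_enorm_toReal (by norm_num) (by norm_num),
    ← ENNReal.rpow_natCast, ← ENNReal.rpow_mul]
  norm_num

theorem volume_ball_eq_ofReal_pow_mul {n : ℕ} (x : EucSpace n) {r : ℝ} (hr : 0 < r) :
    volume (ball x r) = ENNReal.ofReal (r ^ n) * volume (ball (0 : EucSpace n) 1) := by
  rw [Measure.addHaar_ball_of_pos _ _ hr, finrank_euclideanSpace_fin]

/-- Plancherel: `f - 𝓕⁻ h` is the inverse transform of `𝓕 f - h`, which is `𝓕 f` cut off to `sᶜ`. -/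
theorem lintegral_compl_enorm_sq_eq {n : ℕ} (f h : Lp ℂ 2 (volume : Measure (EucSpace n)))
    {s : Set (EucSpace n)} (hs : MeasurableSet s)
    (hh : h =ᵐ[volume] s.indicator (𝓕 f : Lp ℂ 2 (volume : Measure (EucSpace n)))) :
    ∫⁻ x, ‖f x - (𝓕⁻ h : Lp ℂ 2 (volume : Measure (EucSpace n))) x‖ₑ ^ 2 =
      ∫⁻ ξ in sᶜ, ‖(𝓕 f : Lp ℂ 2 (volume : Measure (EucSpace n))) ξ‖ₑ ^ 2 := by
  have h1 : f - 𝓕⁻ h = 𝓕⁻ (𝓕 f - h) := by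
    have := (Lp.fourierTransformₗᵢ (EucSpace n) ℂ).symm.map_sub (𝓕 f) h
    refine Eq.trans ?_ this.symm
    congr 1
    exact ((Lp.fourierTransformₗᵢ (EucSpace n) ℂ).symm_apply_apply f).symm
  calc _ = ∫⁻ x, ‖(f - 𝓕⁻ h : Lp ℂ 2 (volume : Measure (EucSpace n))) x‖ₑ ^ 2 := by
        refine lintegral_congr_ae ?_
        filter_upwards [Lp.coeFn_sub f (𝓕⁻ h)] with x hx
        rw [hx, Pi.sub_apply]
    _ = ‖(𝓕 f - h : Lp ℂ 2 (volume : Measure (EucSpace n)))‖ₑ ^ 2 := by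
        rw [lintegral_enorm_sq_eq, h1]
        congr 1
        exact (Lp.fourierTransformₗᵢ (EucSpace n) ℂ).symm.enorm_map _
    _ = _ := by
        rw [← lintegral_enorm_sq_eq, ← lintegral_indicator hs.compl]
        refine lintegral_congr_ae ?_
        filter_upwards [Lp.coeFn_sub (𝓕 f) h, hh] with ξ hξ hξ'
        rw [hξ, Pi.sub_apply, hξ']
        by_cases hmem : ξ ∈ s <;> simp [hmem]

/-- A function in the critical Sobolev space `H^{n/2}(ℝⁿ)` has vanishing mean oscillation. -/
theorem IsFracLaplacian.eventually_exists_lintegral_ball_le {n : ℕ} (hn : 0 < n)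
    {f v : Lp ℂ 2 (volume : Measure (EucSpace n))} (hfv : IsFracLaplacian ((n : ℝ) / 2) f v)
    {ε : ℝ≥0} (hε : ε ≠ 0) :
    ∀ᶠ r in nhdsWithin (0 : ℝ) (Ioi 0), ∀ x : EucSpace n, ∃ c : ℂ,
      ∫⁻ y in ball x r, ‖f y - c‖ₑ ^ 2 ≤ ε * volume (ball x r) := by
  set a : Lp ℂ 2 (volume : Measure (EucSpace n)) := 𝓕 f with ha
  set v' : Lp ℂ 2 (volume : Measure (EucSpace n)) := 𝓕 v with hv'
  have hpos : volume (ball (0 : EucSpace n) 1) ≠ 0 := (measure_ball_pos _ _ one_pos).ne'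
  obtain ⟨r₁, hr₁, H₁⟩ := exists_lintegral_compl_ball_inv_le (Lp.memLp v') hfv
    (ε := ε / 4 * volume (ball (0 : EucSpace n) 1)) (by simp [hε, hpos])
  -- With `2π ≤ 7`, the low-frequency part varies by at most `7 · 2 · √ε / 32` on the ball, whose
  -- square is below `ε / 4`.
  obtain ⟨r₂, hr₂, H₂⟩ := exists_mul_lintegral_ball_inv_le hn (Lp.memLp a) (Lp.memLp v') hfv
    (ε := NNReal.sqrt ε / 32) (by simp [hε])
  filter_upwards [Ioo_mem_nhdsGT (lt_min hr₁ hr₂)] with r hr x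
  have hr0 : 0 < r := hr.1
  have hmem : MemLp ((ball (0 : EucSpace n) r⁻¹).indicator a) 2 volume :=
    (Lp.memLp a).indicator measurableSet_ball
  set h := hmem.toLp with hh
  have hha : h =ᵐ[volume] (ball (0 : EucSpace n) r⁻¹).indicator a := hmem.coeFn_toLp
  have hi : Integrable h volume := by
    have hfin : IsFiniteMeasure (volume.restrict (ball (0 : EucSpace n) r⁻¹)) :=
      ⟨by simpa using measure_ball_lt_top⟩
    have h1 : Integrable a (volume.restrict (ball (0 : EucSpace n) r⁻¹)) :=
      ((Lp.memLp a).restrict _).integrable (by norm_num)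
    exact (integrable_congr hha).2 ((integrable_indicator_iff measurableSet_ball).2 h1)
  have hmoment : ∫⁻ ξ, ‖ξ‖ₑ * ‖h ξ‖ₑ = ∫⁻ ξ in ball (0 : EucSpace n) r⁻¹, ‖ξ‖ₑ * ‖a ξ‖ₑ := by
    rw [← lintegral_indicator measurableSet_ball]
    refine lintegral_congr_ae ?_
    filter_upwards [hha] with ξ hξ
    rw [hξ]
    by_cases hm : ξ ∈ ball (0 : EucSpace n) r⁻¹ <;> simp only [hm, indicator_of_mem,
      indicator_of_notMem, not_false_eq_true, enorm_zero, mul_zero]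
  set F : EucSpace n → ℂ := 𝓕⁻ (h : EucSpace n → ℂ) with hF
  refine ⟨F x, ?_⟩
  have hlip (y : EucSpace n) (hy : y ∈ ball x r) : ‖F y - F x‖ₑ ^ 2 ≤ (ε / 4 : ℝ≥0) := by
    have h1 : ‖F y - F x‖ₑ ≤ ENNReal.ofReal 7 * (2 * (NNReal.sqrt ε / 32 : ℝ≥0)) := by
      refine (enorm_fourierInv_sub_le hi y x).trans ?_
      rw [hmoment, mul_assoc]
      refine mul_le_mul' (ENNReal.ofReal_le_ofReal (by linarith [Real.pi_lt_d2])) ?_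
      refine le_trans ?_ (H₂ r hr0 (hr.2.trans_le (min_le_right _ _)))
      gcongr
      rw [← ofReal_norm, ← dist_eq_norm]
      exact ENNReal.ofReal_le_ofReal (mem_ball.1 hy).le
    calc _ ≤ (ENNReal.ofReal 7 * (2 * (NNReal.sqrt ε / 32 : ℝ≥0))) ^ 2 := by gcongr
      _ = ((7 * (2 * (NNReal.sqrt ε / 32))) ^ 2 : ℝ≥0) := by push_cast; simp
      _ ≤ _ := by
        rw [ENNReal.coe_le_coe, ← NNReal.coe_le_coe]
        push_cast
        rw [mul_pow, mul_pow, div_pow, Real.sq_sqrt ε.coe_nonneg]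
        linarith [ε.coe_nonneg]
  have hsplit : ∀ᵐ y, y ∈ ball x r → ‖f y - F x‖ₑ ^ 2 ≤
      2 * (‖f y - (𝓕⁻ h : Lp ℂ 2 (volume : Measure (EucSpace n))) y‖ₑ ^ 2 + (ε / 4 : ℝ≥0)) := by
    filter_upwards [fourierInv_Lp_ae_eq h hi] with y hy hyx
    rw [hy]
    calc ‖f y - F x‖ₑ ^ 2 ≤ (‖f y - F y‖ₑ + ‖F y - F x‖ₑ) ^ 2 := by
          gcongr
          rw [← sub_add_sub_cancel (f y) (F y) (F x)]
          exact enorm_add_le _ _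
      _ ≤ 2 * (‖f y - F y‖ₑ ^ 2 + ‖F y - F x‖ₑ ^ 2) := by
          simp only [enorm_eq_nnnorm]
          exact_mod_cast add_sq_le (a := ‖f y - F y‖₊) (b := ‖F y - F x‖₊)
      _ ≤ _ := by gcongr; exact hlip y hyx
  calc ∫⁻ y in ball x r, ‖f y - F x‖ₑ ^ 2
      ≤ ∫⁻ y in ball x r, 2 * (‖f y - (𝓕⁻ h : Lp ℂ 2 (volume : Measure (EucSpace n))) y‖ₑ ^ 2
          + (ε / 4 : ℝ≥0)) := setLIntegral_mono_ae' measurableSet_ball hsplit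
    _ ≤ 2 * ((∫⁻ y, ‖f y - (𝓕⁻ h : Lp ℂ 2 (volume : Measure (EucSpace n))) y‖ₑ ^ 2)
          + (ε / 4 : ℝ≥0) * volume (ball x r)) := by
        rw [lintegral_const_mul' _ _ (by finiteness), lintegral_add_right _ measurable_const,
          setLIntegral_const]
        gcongr
        exact Measure.restrict_le_self
    _ ≤ 2 * ((ε / 4 : ℝ≥0) * volume (ball x r) + (ε / 4 : ℝ≥0) * volume (ball x r)) := by
        gcongr
        rw [lintegral_compl_enorm_sq_eq f h measurableSet_ball hha]
        refine (H₁ r hr0 (hr.2.trans_le (min_le_left _ _))).trans_eq ?_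
        rw [volume_ball_eq_ofReal_pow_mul x hr0]
        push_cast
        ring
    _ = ε * volume (ball x r) := by
        have h2 : (ε : ENNReal) = 2 * ((ε / 4 : ℝ≥0) + (ε / 4 : ℝ≥0)) := by
          norm_cast
          rw [← NNReal.coe_inj]
          push_cast
          ring
        rw [← add_mul, ← mul_assoc, ← h2]

/-- Vanishing mean oscillation for vector-valued functions in `H^{n/2}`. -/
theorem MemFracSobolev.eventually_exists_lintegral_ball_le {n : ℕ} (hn : 0 < n)
    {V : Type*} [NormedAddCommGroup V] [InnerProductSpace ℝ V] [FiniteDimensional ℝ V]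
    {u : EucSpace n → V} (hu : MemFracSobolev ((n : ℝ) / 2) u) {ε : ℝ≥0} (hε : ε ≠ 0) :
    ∀ᶠ r in nhdsWithin (0 : ℝ) (Ioi 0), ∀ x : EucSpace n, ∃ c : V,
      ∫⁻ y in ball x r, ‖u y - c‖ₑ ^ 2 ≤ ε * volume (ball x r) := by
  set N := Module.finrank ℝ V with hN
  set b := stdOrthonormalBasis ℝ V with hb
  have hi (i : Fin N) : ∀ᶠ r in nhdsWithin (0 : ℝ) (Ioi 0), ∀ x : EucSpace n, ∃ c : ℂ,
      ∫⁻ y in ball x r, ‖((inner ℝ (u y) (b i) : ℝ) : ℂ) - c‖ₑ ^ 2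
        ≤ (ε / (N + 1) : ℝ≥0) * volume (ball x r) := by
    obtain ⟨hf, v, hv⟩ := hu.2 (b i)
    filter_upwards [hv.eventually_exists_lintegral_ball_le hn (ε := ε / (N + 1))
      (by positivity)] with r hr x
    obtain ⟨c, hc⟩ := hr x
    refine ⟨c, le_trans (le_of_eq (lintegral_congr_ae ?_)) hc⟩
    filter_upwards [ae_restrict_of_ae hf.coeFn_toLp] with y hy
    rw [hy]
  filter_upwards [Filter.eventually_all.2 hi] with r hr x
  choose c hc using fun i => hr i x
  -- The coordinates of `u` are real, so passing to real parts only decreases the distance to `c i`.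
  refine ⟨∑ i, (c i).re • b i, ?_⟩
  have hpt (y : EucSpace n) : ‖u y - ∑ i, (c i).re • b i‖ₑ ^ 2 ≤
      ∑ i, ‖((inner ℝ (u y) (b i) : ℝ) : ℂ) - c i‖ₑ ^ 2 := by
    simp_rw [← ofReal_norm, ← ENNReal.ofReal_pow (norm_nonneg _)]
    rw [← ENNReal.ofReal_sum_of_nonneg fun _ _ => by positivity]
    apply ENNReal.ofReal_le_ofReal
    rw [← b.sum_sq_norm_inner_right]
    refine Finset.sum_le_sum fun i _ => ?_
    have h1 : inner ℝ (b i) (u y - ∑ j, (c j).re • b j) = inner ℝ (u y) (b i) - (c i).re := by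
      rw [inner_sub_right, real_inner_comm, b.orthonormal.inner_right_fintype]
    rw [h1]
    gcongr
    have h2 := Complex.abs_re_le_norm (((inner ℝ (u y) (b i) : ℝ) : ℂ) - c i)
    simpa using h2
  have hmeas (i : Fin N) : AEMeasurable
      (fun y => ‖((inner ℝ (u y) (b i) : ℝ) : ℂ) - c i‖ₑ ^ 2) (volume.restrict (ball x r)) := by
    obtain ⟨hf, -⟩ := hu.2 (b i)
    exact ((hf.1.restrict.sub aestronglyMeasurable_const).enorm.pow_const 2)
  calc _ ≤ ∫⁻ y in ball x r, ∑ i, ‖((inner ℝ (u y) (b i) : ℝ) : ℂ) - c i‖ₑ ^ 2 :=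
        lintegral_mono hpt
    _ = ∑ i, ∫⁻ y in ball x r, ‖((inner ℝ (u y) (b i) : ℝ) : ℂ) - c i‖ₑ ^ 2 :=
        lintegral_finsetSum' _ fun i _ => hmeas i
    _ ≤ ∑ _i : Fin N, (ε / (N + 1) : ℝ≥0) * volume (ball x r) :=
        Finset.sum_le_sum fun i _ => hc i
    _ = (N * (ε / (N + 1)) : ℝ≥0) * volume (ball x r) := by
        simp [mul_assoc]
    _ ≤ _ := by
        gcongr
        rw [mul_div_left_comm]
        refine mul_le_of_le_one_right (by positivity) (div_le_one_of_le₀ ?_ (by positivity))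
        exact le_self_add

/-! ### Exterior balls at a smooth boundary -/

/-- A domain with smooth boundary contains, near each boundary point, exterior balls of comparable
size at all small scales. -/
theorem HasSmoothBoundary.exists_exterior_ball {n : ℕ} {D : Set (EucSpace n)} (hD : IsOpen D)
    (hs : HasSmoothBoundary D) {p : EucSpace n} (hp : p ∈ frontier D) :
    ∃ κ > 0, ∃ e : EucSpace n, ∃ δ > 0, ∀ q ∈ frontier D, dist q p < δ → ∀ d, 0 < d → d < δ →
      ball (q + d • e) (κ * d) ⊆ ball q d \ D := by
  obtain ⟨U, hU, hpU, ρ, hρ, hρ', hDU⟩ := hs p hp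
  set L := fderiv ℝ ρ p with hL
  have hstrict : HasStrictFDerivAt ρ L p :=
    (hρ.contDiffAt (hU.mem_nhds hpU)).hasStrictFDerivAt (by simp)
  obtain ⟨e, hLe, he⟩ : ∃ e, 0 < L e ∧ ‖e‖ ≤ 1 / 2 := by
    obtain ⟨e₁, he₁⟩ : ∃ e, 0 < L e := by
      by_contra! h
      refine hρ' p hpU (ContinuousLinearMap.ext fun x => le_antisymm (h x) ?_)
      have := h (-x)
      rw [map_neg] at this
      simpa using this
    have hne : 0 < ‖e₁‖ := norm_pos_iff.2 fun h => by simp [h] at he₁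
    refine ⟨(1 / (2 * ‖e₁‖)) • e₁, ?_, ?_⟩
    · rw [map_smul, smul_eq_mul]; positivity
    · rw [norm_smul, Real.norm_of_nonneg (by positivity)]
      field_simp
      rfl
  set l := L e with hl
  obtain ⟨δ, hδ, hball⟩ : ∃ δ > 0, ∀ x ∈ ball p δ, ∀ y ∈ ball p δ,
      x ∈ U ∧ ‖ρ x - ρ y - L (x - y)‖ ≤ l / 4 * ‖x - y‖ := by
    have h1 := hstrict.isLittleO.def (c := l / 4) (by positivity)
    have h2 : ∀ᶠ x in nhds p, x ∈ U := hU.mem_nhds hpU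
    obtain ⟨ε, hε, h3⟩ := Metric.mem_nhds_iff.1 ((h2.prod_inl_nhds p).and h1)
    refine ⟨ε, hε, fun x hx y hy => h3 (show (x, y) ∈ ball (p, p) ε from ?_)⟩
    rw [← ball_prod_same]
    exact ⟨hx, hy⟩
  -- The bound `κ ≤ 1/2`, with `‖e‖ ≤ 1/2`, keeps the ball inside `ball q d`. The second bound gives
  -- `|L k| ≤ ld/2`. So `L (z - q) ≥ ld/2` beats the linearisation error `ld/4`, forcing `ρ z > ρ q
  -- ≥ 0`. Halving `δ` keeps `z` in `ball p δ`.
  refine ⟨min (1 / 2) (l / (2 * (‖L‖ + 1))), by positivity, e, δ / 2, by positivity,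
    fun q hq hqp d hd hdδ z hz => ?_⟩
  set κ := min (1 / 2) (l / (2 * (‖L‖ + 1))) with hκ
  have hκ1 : κ ≤ 1 / 2 := min_le_left _ _
  have hκ2 : ‖L‖ * κ ≤ l / 2 := by
    have : κ * (2 * (‖L‖ + 1)) ≤ l := (le_div_iff₀ (by positivity)).1 (min_le_right _ _)
    have : 0 < κ := by positivity
    nlinarith
  set k := z - (q + d • e) with hk
  have hkn : ‖k‖ < κ * d := by rwa [mem_ball, dist_eq_norm] at hz
  have hzq : z - q = d • e + k := by rw [hk]; abel
  have hzq_lt : ‖z - q‖ < d := by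
    rw [hzq]
    refine (norm_add_le _ _).trans_lt ?_
    rw [norm_smul, Real.norm_of_nonneg hd.le]
    nlinarith
  refine ⟨by rwa [mem_ball, dist_eq_norm], fun hzD => ?_⟩
  have hqδ : q ∈ ball p δ := by rw [mem_ball]; linarith
  have hzδ : z ∈ ball p δ := by
    rw [mem_ball]
    have := dist_triangle z q p
    rw [dist_eq_norm z q] at this
    linarith
  obtain ⟨hzU, hest⟩ := hball z hzδ q hqδ
  have hqU := (hball q hqδ q hqδ).1
  have hρz : ρ z < 0 := by
    have : z ∈ D ∩ U := ⟨hzD, hzU⟩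
    rw [hDU] at this
    exact this.2
  have hρq : 0 ≤ ρ q := by
    by_contra! h
    have h2 : q ∈ D ∩ U := by rw [hDU]; exact ⟨hqU, h⟩
    rw [frontier, hD.interior_eq] at hq
    exact hq.2 h2.1
  have hLk : -(‖L‖ * (κ * d)) ≤ L k := by
    have h1 := (L.le_opNorm k).trans (mul_le_mul_of_nonneg_left hkn.le (norm_nonneg L))
    exact (abs_le.1 h1).1
  have hLz : L (z - q) = d * l + L k := by rw [hzq, map_add, map_smul, smul_eq_mul]
  have h3 := (abs_le.1 hest).1
  rw [hLz] at h3
  have h4 : l / 4 * ‖z - q‖ ≤ l / 4 * d := by gcongr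
  nlinarith

/-! ### The continuous representative inside the domain -/

theorem exists_mem_ball_of_ae {n : ℕ} {P : EucSpace n → Prop} {x : EucSpace n} {r : ℝ} (hr : 0 < r)
    (h : ∀ᵐ y, y ∈ ball x r → P y) : ∃ y ∈ ball x r, P y := by
  by_contra! hcon
  have : volume (ball x r) = 0 := by
    refine measure_mono_null (fun y hy => ?_) (ae_iff.1 h)
    exact fun hP => hcon y hy (hP hy)
  exact (measure_ball_pos volume x hr).ne' this

theorem exists_modulus {K r α : ℝ} (hα : 0 < α) {ε : ℝ} (hε : 0 < ε) :
    ∃ η > 0, ∀ t, 0 ≤ t → t < η → K * (t ^ α / r ^ α + t ^ α) ≤ ε := by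
  have hc : ContinuousAt (fun t : ℝ => K * (t ^ α / r ^ α + t ^ α)) 0 := by
    have : ContinuousAt (fun t : ℝ => t ^ α) 0 := Real.continuousAt_rpow_const _ _ (.inr hα.le)
    fun_prop
  have h0 : K * ((0 : ℝ) ^ α / r ^ α + 0 ^ α) = 0 := by rw [Real.zero_rpow hα.ne']; simp
  obtain ⟨η, hη, h⟩ := Metric.continuousAt_iff.1 hc ε hε
  refine ⟨η, hη, fun t ht htη => ?_⟩
  have := h (x := t) (by rwa [Real.dist_eq, sub_zero, abs_of_nonneg ht])
  rw [h0, Real.dist_eq, sub_zero] at this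
  exact (abs_lt.1 this).2.le

section Representative

variable {n : ℕ} {V : Type*} [NormedAddCommGroup V]

/-- The points of `D` at which `u` is continuous up to a null set. -/
def essContinuityPoints (u : EucSpace n → V) (D : Set (EucSpace n)) : Set (EucSpace n) :=
  {x ∈ D | ∀ ε > 0, ∃ δ > 0, ∀ᵐ y, y ∈ ball x δ → ‖u x - u y‖ ≤ ε}

variable {u : EucSpace n → V} {D : Set (EucSpace n)} {Λ K α : ℝ}

theorem InteriorHolderEstimate.ae_ball (hint : InteriorHolderEstimate u D Λ K α)
    {x₀ : EucSpace n} {r : ℝ} (hr : 0 < r) (hball : ball x₀ (Λ * r) ⊆ D) :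
    ∀ᵐ x, x ∈ ball x₀ r → ∀ᵐ y, y ∈ ball x₀ r →
      ‖u x - u y‖ ≤ K * (‖x - y‖ ^ α / r ^ α + ‖x - y‖ ^ α) := by
  have h := hint x₀ r hr hball
  rw [ae_restrict_iff' measurableSet_ball] at h
  filter_upwards [h] with x hx hxb
  have h2 := hx hxb
  rwa [ae_restrict_iff' measurableSet_ball] at h2

theorem exists_scaled_ball_subset (hD : IsOpen D) (hΛ : 1 ≤ Λ) {x : EucSpace n} (hx : x ∈ D) :
    ∃ r > 0, ball x (Λ * r) ⊆ D := by
  obtain ⟨ρ, hρ, h⟩ := Metric.isOpen_iff.1 hD x hx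
  refine ⟨ρ / Λ, by positivity, ?_⟩
  rwa [mul_div_cancel₀ _ (by positivity)]

theorem InteriorHolderEstimate.volume_diff_essContinuityPoints
    (hint : InteriorHolderEstimate u D Λ K α) (hD : IsOpen D) (hΛ : 1 ≤ Λ) (hα : 0 < α) :
    volume (D \ essContinuityPoints u D) = 0 := by
  refine measure_null_of_locally_null _ fun x hx => ?_
  obtain ⟨r, hr, hball⟩ := exists_scaled_ball_subset hD hΛ hx.1
  refine ⟨ball x r ∩ (D \ essContinuityPoints u D),
    Filter.inter_mem (mem_nhdsWithin_of_mem_nhds (ball_mem_nhds x hr)) self_mem_nhdsWithin, ?_⟩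
  refine measure_mono_null (fun y hy => ?_) (ae_iff.1 (hint.ae_ball hr hball))
  intro hgood
  have hy' := hgood hy.1
  refine hy.2.2 ⟨hy.2.1, fun ε hε => ?_⟩
  obtain ⟨η, hη, hmod⟩ := exists_modulus (K := K) (r := r) hα hε
  have hyr : dist y x < r := hy.1
  refine ⟨min η (r - dist y x), lt_min hη (by linarith), ?_⟩
  filter_upwards [hy'] with z hz hzb
  rw [mem_ball] at hzb
  have hz1 := hzb.trans_le (min_le_left _ _)
  have hz2 := hzb.trans_le (min_le_right _ _)
  refine (hz ?_).trans (hmod _ (norm_nonneg _) ?_)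
  · rw [mem_ball]; linarith [dist_triangle z y x]
  · rwa [← dist_eq_norm, dist_comm]

theorem InteriorHolderEstimate.subset_closure_essContinuityPoints
    (hint : InteriorHolderEstimate u D Λ K α) (hD : IsOpen D) (hΛ : 1 ≤ Λ) (hα : 0 < α) :
    D ⊆ closure (essContinuityPoints u D) := by
  intro x hx
  rw [Metric.mem_closure_iff]
  intro ε hε
  obtain ⟨ρ, hρ, h⟩ := Metric.isOpen_iff.1 hD x hx
  have hae : ∀ᵐ y, y ∈ ball x (min ε ρ) → y ∈ essContinuityPoints u D := by
    refine ae_iff.2 (measure_mono_null (fun y hy => ?_)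
      (hint.volume_diff_essContinuityPoints hD hΛ hα))
    simp only [mem_ofPred_eq, Classical.not_imp] at hy
    exact ⟨h (ball_subset_ball (min_le_right _ _) hy.1), hy.2⟩
  obtain ⟨y, hy, hyE⟩ := exists_mem_ball_of_ae (lt_min hε hρ) hae
  exact ⟨y, hyE, by rw [dist_comm]; exact (mem_ball.1 hy).trans_le (min_le_left _ _)⟩

/-- Cauchy criterion: two points of essential continuity are each replaced by nearby points at which
the a.e. estimate applies. -/
theorem InteriorHolderEstimate.exists_tendsto [CompleteSpace V]
    (hint : InteriorHolderEstimate u D Λ K α) (hD : IsOpen D) (hΛ : 1 ≤ Λ) (hα : 0 < α)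
    {x : EucSpace n} (hx : x ∈ D) :
    ∃ c, Filter.Tendsto u (nhdsWithin x (essContinuityPoints u D)) (nhds c) := by
  have hne : (nhdsWithin x (essContinuityPoints u D)).NeBot :=
    mem_closure_iff_nhdsWithin_neBot.1 (hint.subset_closure_essContinuityPoints hD hΛ hα hx)
  rw [← cauchy_map_iff_exists_tendsto, Metric.cauchy_iff]
  refine ⟨Filter.map_neBot, fun ε hε => ?_⟩
  obtain ⟨r, hr, hball⟩ := exists_scaled_ball_subset hD hΛ hx
  obtain ⟨η, hη, hmod⟩ := exists_modulus (K := K) (r := r) hα (ε := ε / 4) (by positivity)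
  set s := min (η / 2) r with hs
  have hs0 : 0 < s := by positivity
  refine ⟨u '' (ball x s ∩ essContinuityPoints u D), Filter.image_mem_map
    (Filter.inter_mem (mem_nhdsWithin_of_mem_nhds (ball_mem_nhds x hs0)) self_mem_nhdsWithin), ?_⟩
  rintro _ ⟨y, ⟨hy, hyE⟩, rfl⟩ _ ⟨z, ⟨hz, hzE⟩, rfl⟩
  have approx {y : EucSpace n} (hy : y ∈ ball x s) (hyE : y ∈ essContinuityPoints u D)
      {P : EucSpace n → Prop} (hP : ∀ᵐ y', y' ∈ ball x r → P y') :
      ∃ y' ∈ ball x s, P y' ∧ ‖u y - u y'‖ ≤ ε / 4 := by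
    obtain ⟨δ, hδ, hae⟩ := hyE.2 (ε / 4) (by positivity)
    have hys : dist y x < s := hy
    obtain ⟨y', hy', h'⟩ := exists_mem_ball_of_ae (P := fun y' => y' ∈ ball x s ∧ P y' ∧
        ‖u y - u y'‖ ≤ ε / 4) (x := y) (lt_min hδ (sub_pos.2 hys)) (by
      filter_upwards [hae, hP] with y' h1 h2 hy'
      rw [mem_ball] at hy'
      have h3 := hy'.trans_le (min_le_left _ _)
      have h4 := hy'.trans_le (min_le_right _ _)
      have h5 : y' ∈ ball x s := by rw [mem_ball]; linarith [dist_triangle y' y x]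
      exact ⟨h5, h2 (ball_subset_ball (min_le_right _ _) h5), h1 h3⟩)
    exact ⟨y', h'⟩
  -- The order matters: `y'` is fixed first, because the null set that `z'` must avoid depends on
  -- it.
  obtain ⟨y', hys', hyP, hyy⟩ := approx hy hyE (hint.ae_ball hr hball)
  obtain ⟨z', hzs', hzP, hzz⟩ := approx hz hzE hyP
  have hyz : ‖u y' - u z'‖ ≤ ε / 4 := by
    refine hzP.trans (hmod _ (norm_nonneg _) ?_)
    rw [← dist_eq_norm]
    have h1 := (mem_ball.1 hys').trans_le (min_le_left _ _)
    have h2 := (mem_ball.1 hzs').trans_le (min_le_left _ _)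
    linarith [dist_triangle_right y' z' x]
  have h := dist_triangle4 (u y) (u y') (u z') (u z)
  rw [dist_eq_norm (u y) (u y'), dist_eq_norm (u y') (u z'), dist_comm (u z') (u z),
    dist_eq_norm (u z) (u z')] at h
  linarith

theorem InteriorHolderEstimate.exists_continuousOn [CompleteSpace V]
    (hint : InteriorHolderEstimate u D Λ K α) (hD : IsOpen D) (hΛ : 1 ≤ Λ) (hα : 0 < α) :
    ∃ w : EucSpace n → V, ContinuousOn w D ∧ ∀ᵐ x, x ∈ D → w x = u x := by
  have hcl := hint.subset_closure_essContinuityPoints hD hΛ hα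
  refine ⟨extendFrom (essContinuityPoints u D) u,
    continuousOn_extendFrom hcl fun x hx => hint.exists_tendsto hD hΛ hα hx, ?_⟩
  refine ae_iff.2 (measure_mono_null (fun x hx => ?_)
    (hint.volume_diff_essContinuityPoints hD hΛ hα))
  simp only [mem_ofPred_eq, Classical.not_imp] at hx
  refine ⟨hx.1, fun hxE => hx.2 ?_⟩
  obtain ⟨c, hc⟩ := hint.exists_tendsto hD hΛ hα hx.1
  have : u x = c := tendsto_nhds_unique (tendsto_pure_nhds u x)
    (hc.mono_left (pure_le_nhdsWithin hxE))
  exact extendFrom_eq (hcl hx.1) (this ▸ hc)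

/-- The interior estimate holds everywhere for a continuous representative. -/
theorem InteriorHolderEstimate.forall_ball (hint : InteriorHolderEstimate u D Λ K α)
    (hΛ : 1 ≤ Λ) (hα : 0 < α) {w : EucSpace n → V}
    (hw : ContinuousOn w D) (hwu : ∀ᵐ x, x ∈ D → w x = u x)
    {x₀ : EucSpace n} {r : ℝ} (hr : 0 < r) (hball : ball x₀ (Λ * r) ⊆ D)
    {x y : EucSpace n} (hx : x ∈ ball x₀ r) (hy : y ∈ ball x₀ r) :
    ‖w x - w y‖ ≤ K * (‖x - y‖ ^ α / r ^ α + ‖x - y‖ ^ α) := by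
  have hsub : ball x₀ r ⊆ D := (ball_subset_ball (by nlinarith)).trans hball
  have hwc := hw.mono hsub
  -- An a.e. inequality between continuous functions on an open set is the a.e. equality `max F G =
  -- G`, hence holds everywhere. It is applied in `y` for almost every `x`, then in `x` for every
  -- `y`.
  have ext {F G : EucSpace n → ℝ} (hF : ContinuousOn F (ball x₀ r)) (hG : Continuous G)
      (h : ∀ᵐ y, y ∈ ball x₀ r → F y ≤ G y) : ∀ y ∈ ball x₀ r, F y ≤ G y := by
    intro y hy
    have h1 : (fun y => max (F y) (G y)) =ᵐ[volume.restrict (ball x₀ r)] G := by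
      rw [Filter.EventuallyEq, ae_restrict_iff' measurableSet_ball]
      filter_upwards [h] with z hz hzb
      exact max_eq_right (hz hzb)
    have h2 := Measure.eqOn_open_of_ae_eq h1 isOpen_ball (ContinuousOn.sup hF hG.continuousOn)
      hG.continuousOn hy
    exact max_eq_right_iff.1 h2
  have hpow (z : EucSpace n) :
      Continuous fun y : EucSpace n => K * (‖z - y‖ ^ α / r ^ α + ‖z - y‖ ^ α) := by
    have : Continuous fun y : EucSpace n => ‖z - y‖ ^ α :=
      (by fun_prop : Continuous fun y : EucSpace n => ‖z - y‖).rpow_const fun _ => .inr hα.le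
    fun_prop
  have h1 : ∀ᵐ x, x ∈ ball x₀ r → ∀ y ∈ ball x₀ r,
      ‖w x - w y‖ ≤ K * (‖x - y‖ ^ α / r ^ α + ‖x - y‖ ^ α) := by
    filter_upwards [hint.ae_ball hr hball, hwu] with x hx hwx hxb
    refine ext ((continuousOn_const.sub hwc).norm) (hpow x) ?_
    filter_upwards [hx hxb, hwu] with y hy hwy hyb
    rw [hwx (hsub hxb), hwy (hsub hyb)]
    exact hy hyb
  have h2 := ext (F := fun x => ‖w x - w y‖)
    (G := fun x => K * (‖y - x‖ ^ α / r ^ α + ‖y - x‖ ^ α))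
    ((hwc.sub continuousOn_const).norm) (hpow y) (by
      filter_upwards [h1] with x hx hxb
      rw [norm_sub_rev y x]
      exact hx hxb y hy) x hx
  simpa only [norm_sub_rev y x] using h2

end Representative

/-! ### Continuity up to the boundary -/

theorem holderOnWith_of_norm_sub_le {E V : Type*} [NormedAddCommGroup E] [NormedAddCommGroup V]
    {w : E → V} {s : Set E} {C α : ℝ≥0}
    (h : ∀ x ∈ s, ∀ y ∈ s, ‖w x - w y‖ ≤ C * ‖x - y‖ ^ (α : ℝ)) : HolderOnWith C α w s := by
  intro x hx y hy
  rw [edist_dist, edist_dist, ENNReal.ofReal_rpow_of_nonneg dist_nonneg α.coe_nonneg,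
    ← ENNReal.ofReal_coe_nnreal, ← ENNReal.ofReal_mul C.coe_nonneg, dist_eq_norm, dist_eq_norm]
  exact ENNReal.ofReal_le_ofReal (h x hx y hy)

/-- A function that is close to `c` in quadratic mean on a set is close to `c` at some point of any
subset of comparable measure, and this point can be taken outside a null set. -/
theorem exists_enorm_sub_sq_lt {α V : Type*} [MeasurableSpace α] {μ : Measure α}
    [NormedAddCommGroup V] {u : α → V} {A B : Set α} (hA : MeasurableSet A) (hAB : A ⊆ B) {c : V}
    {η θ : ENNReal} (hB : ∫⁻ y in B, ‖u y - c‖ₑ ^ 2 ∂μ ≤ η * μ B) (hlt : η * μ B < θ * μ A)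
    {P : α → Prop} (hP : ∀ᵐ y ∂μ, y ∈ A → P y) : ∃ y ∈ A, P y ∧ ‖u y - c‖ₑ ^ 2 < θ := by
  by_contra! hcon
  refine (hlt.trans_le ?_).not_ge hB
  calc θ * μ A = ∫⁻ _ in A, θ ∂μ := (setLIntegral_const _ _).symm
    _ ≤ ∫⁻ y in A, ‖u y - c‖ₑ ^ 2 ∂μ := by
        refine setLIntegral_mono_ae' hA ?_
        filter_upwards [hP] with y hy hyA
        exact hcon y hyA (hy hyA)
    _ ≤ _ := lintegral_mono_set hAB

theorem exists_frontier_dist_eq {n : ℕ} {D : Set (EucSpace n)} (hD : IsOpen D)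
    {p x : EucSpace n} (hp : p ∉ D) (hx : x ∈ D) :
    ∃ q ∈ frontier D, 0 < dist x q ∧ dist x q ≤ dist x p ∧ ball x (dist x q) ⊆ D := by
  obtain ⟨q, hq, hqd⟩ := hD.isClosed_compl.exists_infDist_eq_dist ⟨p, hp⟩ x
  have hball : ball x (dist x q) ⊆ D := by
    rw [← hqd]
    exact disjoint_compl_right_iff_subset.1 disjoint_ball_infDist
  have hpos : 0 < dist x q := dist_pos.2 fun h => hq (h ▸ hx)
  refine ⟨q, ?_, hpos, hqd ▸ infDist_le_dist_of_mem hp, hball⟩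
  rw [frontier, hD.interior_eq]
  refine ⟨closure_mono hball ?_, hq⟩
  rw [closure_ball x hpos.ne', mem_closedBall, dist_comm]

theorem exists_pos_two_mul_rpow_le {K α ε : ℝ} (hα : 0 < α) (hε : 0 < ε) :
    ∃ δ, 0 < δ ∧ δ < 1 ∧ K * (δ ^ α + δ ^ α) ≤ ε := by
  obtain ⟨η, hη, h⟩ := exists_modulus (K := K) (r := 1) hα hε
  refine ⟨min (η / 2) (1 / 2), by positivity, ?_, ?_⟩
  · exact (min_le_right _ _).trans_lt (by norm_num)
  · have := h (min (η / 2) (1 / 2)) (by positivity) ((min_le_left _ _).trans_lt (by linarith))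
    simpa using this

/-- Continuity up to the boundary: the values inside `D` attain the exterior values. -/
theorem tendsto_nhdsWithin_frontier {n : ℕ} {V : Type*} [NormedAddCommGroup V]
    {u w g : EucSpace n → V} {D T : Set (EucSpace n)} (hD : IsOpen D) (hT : IsOpen T)
    (hs : HasSmoothBoundary D)
    (hvmo : ∀ ε : ℝ≥0, ε ≠ 0 → ∀ᶠ r in nhdsWithin (0 : ℝ) (Ioi 0), ∀ x : EucSpace n, ∃ c : V,
      ∫⁻ y in ball x r, ‖u y - c‖ₑ ^ 2 ≤ ε * volume (ball x r))
    {Λ K α : ℝ} (hΛ : 1 ≤ Λ) (hK : 0 ≤ K) (hα : 0 < α)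
    (hw : ∀ (x₀ : EucSpace n) (r : ℝ), 0 < r → ball x₀ (Λ * r) ⊆ D →
      ∀ x ∈ ball x₀ r, ∀ y ∈ ball x₀ r, ‖w x - w y‖ ≤ K * (‖x - y‖ ^ α / r ^ α + ‖x - y‖ ^ α))
    (hwu : ∀ᵐ x, x ∈ D → w x = u x) (hug : ∀ᵐ x, x ∈ T \ D → u x = g x)
    {p : EucSpace n} (hp : p ∈ frontier D) (hpT : p ∈ T) (hg : ContinuousWithinAt g (T \ D) p) :
    Filter.Tendsto w (nhdsWithin p D) (nhds (g p)) := by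
  rw [Metric.tendsto_nhdsWithin_nhds]
  intro ε hε
  obtain ⟨κ, hκ, e, δ₀, hδ₀, hext⟩ := hs.exists_exterior_ball hD hp
  obtain ⟨δ, hδ, hδ1, hKδ⟩ := exists_pos_two_mul_rpow_le (K := K) hα (ε := ε / 4) (by positivity)
  obtain ⟨δ₁, hδ₁, hgδ⟩ := Metric.continuousWithinAt_iff.1 hg (ε / 4) (by positivity)
  obtain ⟨δ₂, hδ₂, hTδ⟩ := Metric.isOpen_iff.1 hT p hpT
  -- Both test balls have radius at least `τ * d`, so each fills at least the fraction `(τ/2)^n` of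
  -- `ball x (2 * d)`. The extra `/ 2` in `η` makes the comparison strict.
  set τ := min (δ / Λ) κ with hτ
  have hτ0 : 0 < τ := by positivity
  have hΛ0 : 0 < Λ := by positivity
  set η : ℝ := (ε / 4) ^ 2 * (τ / 2) ^ n / 2 with hη
  have hη0 : 0 < η := by positivity
  obtain ⟨δ₃, hδ₃, hosc⟩ := mem_nhdsGT_iff_exists_Ioo_subset.1
    (hvmo η.toNNReal (by simpa using hη0))
  rw [mem_Ioi] at hδ₃
  have hpD : p ∉ D := by
    rw [frontier, hD.interior_eq] at hp
    exact hp.2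
  -- Points of the exterior ball lie within `3 * dist x p` of `p`, whence the thirds. The bound `1`
  -- gives `d / Λ ≤ 1`, needed for the unscaled term of the estimate.
  refine ⟨min (min (δ₀ / 3) (δ₁ / 3)) (min (δ₂ / 3) (min (δ₃ / 3) 1)), by positivity,
    fun x hxD hxp => ?_⟩
  simp only [lt_min_iff] at hxp
  obtain ⟨q, hq, hd, hdp, hball⟩ := exists_frontier_dist_eq hD hpD hxD
  set d := dist x q with hdef
  have hqp : dist q p ≤ 2 * dist x p := by
    have := dist_triangle_left q p x
    linarith
  have hextq := hext q hq (by linarith) d hd (by linarith)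
  obtain ⟨c, hc⟩ := hosc (⟨by positivity, by linarith⟩ : 2 * d ∈ Ioo 0 δ₃) x
  have hsmall {z : EucSpace n} {s : ℝ} (hs : τ * d ≤ s) :
      ENNReal.ofReal η * volume (ball x (2 * d)) <
        ENNReal.ofReal ((ε / 4) ^ 2) * volume (ball z s) := by
    have hs0 : 0 < s := (by positivity : 0 < τ * d).trans_le hs
    rw [volume_ball_eq_ofReal_pow_mul x (by positivity), volume_ball_eq_ofReal_pow_mul z hs0,
      ← mul_assoc, ← mul_assoc, ENNReal.mul_lt_mul_iff_left (measure_ball_pos _ _ one_pos).ne'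
        measure_ball_lt_top.ne,
      ← ENNReal.ofReal_mul hη0.le, ← ENNReal.ofReal_mul (by positivity),
      ENNReal.ofReal_lt_ofReal_iff (by positivity)]
    calc η * (2 * d) ^ n = (ε / 4) ^ 2 * (τ * d) ^ n / 2 := by
          have : (τ * d) ^ n = (τ / 2) ^ n * (2 * d) ^ n := by
            rw [← mul_pow]
            congr 1
            ring
          rw [hη, this]
          ring
      _ < (ε / 4) ^ 2 * (τ * d) ^ n := half_lt_self (by positivity)
      _ ≤ (ε / 4) ^ 2 * s ^ n := by gcongr
  have hnorm {v : V} (hv : ‖v‖ₑ ^ 2 < ENNReal.ofReal ((ε / 4) ^ 2)) : ‖v‖ < ε / 4 := by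
    rw [← ofReal_norm, ← ENNReal.ofReal_pow (norm_nonneg _),
      ENNReal.ofReal_lt_ofReal_iff (by positivity)] at hv
    exact lt_of_pow_lt_pow_left₀ 2 (by positivity) hv
  have hr : 0 < d / Λ := by positivity
  have hrd : d / Λ ≤ d := div_le_self hd.le hΛ
  have hballr : ball x (Λ * (d / Λ)) ⊆ D := by rwa [mul_div_cancel₀ _ hΛ0.ne']
  have hδr : δ * (d / Λ) ≤ d / Λ := mul_le_of_le_one_left hr.le hδ1.le
  obtain ⟨y, hy, hyu, hyc⟩ := exists_enorm_sub_sq_lt (A := ball x (δ * (d / Λ))) measurableSet_ball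
    (ball_subset_ball (by linarith)) hc
    (hsmall (by
      calc τ * d ≤ δ / Λ * d := by gcongr; exact min_le_left _ _
        _ = _ := by ring))
    (P := fun y => w y = u y) (by
      filter_upwards [hwu] with y hy hyb
      exact hy (hball (ball_subset_ball (by linarith) hyb)))
  obtain ⟨z, hz, ⟨hzT, hzu⟩, hzc⟩ := exists_enorm_sub_sq_lt (A := ball (q + d • e) (κ * d))
    measurableSet_ball (fun z hz => by
      have h1 := mem_ball.1 (hextq hz).1
      rw [mem_ball]
      linarith [dist_triangle_right z x q]) hc
    (hsmall (by gcongr; exact min_le_right _ _))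
    (P := fun z => (z ∈ T \ D ∧ dist z p < δ₁) ∧ u z = g z) (by
      filter_upwards [hug] with z hz hzb
      have h1 := mem_ball.1 (hextq hzb).1
      have h2 : dist z p < 3 * dist x p := by linarith [dist_triangle z q p]
      have h3 : z ∈ T \ D := ⟨hTδ (by rw [mem_ball]; linarith), (hextq hzb).2⟩
      exact ⟨⟨h3, by linarith⟩, hz h3⟩)
  have hwxy : ‖w x - w y‖ ≤ ε / 4 := by
    refine (hw x (d / Λ) hr hballr x (mem_ball_self hr) y (ball_subset_ball hδr hy)).trans ?_
    refine le_trans ?_ hKδ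
    have hxy : ‖x - y‖ ≤ δ * (d / Λ) := by
      rw [← dist_eq_norm, dist_comm]
      exact (mem_ball.1 hy).le
    gcongr
    · rw [← Real.div_rpow (norm_nonneg _) hr.le]
      gcongr
      rwa [div_le_iff₀ hr]
    · exact hxy.trans (mul_le_of_le_one_right hδ.le (by linarith))
  have h1 := hnorm hyc
  have h2 := hnorm hzc
  have h3 := hgδ hzT.1 hzT.2
  rw [← hyu] at h1
  rw [hzu] at h2
  calc dist (w x) (g p) ≤ dist (w x) (w y) + dist (w y) c + dist c (g z) + dist (g z) (g p) :=
        (dist_triangle (w x) (g z) (g p)).trans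
          (by gcongr; exact dist_triangle4 (w x) (w y) c (g z))
    _ < ε := by
        rw [dist_comm c, dist_eq_norm (w x), dist_eq_norm (w y), dist_eq_norm (g z) c]
        linarith

/-! ### Hölder bounds on balls and compact sets -/

section Holder

variable {n : ℕ} {V : Type*} [NormedAddCommGroup V] {w : EucSpace n → V} {D : Set (EucSpace n)}
  {Λ K : ℝ} {α : ℝ≥0}

theorem exists_holderOnWith_ball (hK : 0 ≤ K) {x₀ : EucSpace n} {r : ℝ} (hr : 0 < r)
    (hw : ∀ x ∈ ball x₀ r, ∀ y ∈ ball x₀ r,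
      ‖w x - w y‖ ≤ K * (‖x - y‖ ^ (α : ℝ) / r ^ (α : ℝ) + ‖x - y‖ ^ (α : ℝ))) :
    ∃ C : ℝ≥0, HolderOnWith C α w (ball x₀ r) := by
  refine ⟨NNReal.mk (K * (1 / r ^ (α : ℝ) + 1)) (by positivity), holderOnWith_of_norm_sub_le
    fun x hx y hy => (hw x hx y hy).trans_eq ?_⟩
  rw [NNReal.coe_mk]
  ring

/-- Balls about points of `S` fit into `D` at one uniform scale `r`. Pairs closer than `r` use the
interior estimate; for the others, boundedness of `w` on `S` suffices, as `|x - y|^α ≥ r^α`. -/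
theorem exists_holderOnWith_compact (hD : IsOpen D) (hΛ : 1 ≤ Λ) (hK : 0 ≤ K)
    (hwD : ContinuousOn w D)
    (hw : ∀ (x₀ : EucSpace n) (r : ℝ), 0 < r → ball x₀ (Λ * r) ⊆ D →
      ∀ x ∈ ball x₀ r, ∀ y ∈ ball x₀ r,
        ‖w x - w y‖ ≤ K * (‖x - y‖ ^ (α : ℝ) / r ^ (α : ℝ) + ‖x - y‖ ^ (α : ℝ)))
    {S : Set (EucSpace n)} (hS : IsCompact S) (hSD : S ⊆ D) :
    ∃ C : ℝ≥0, HolderOnWith C α w S := by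
  obtain ⟨δ, hδ, hthick⟩ := hS.exists_thickening_subset_open hD hSD
  obtain ⟨M, hM⟩ := hS.exists_bound_of_continuousOn (hwD.mono hSD)
  set r := δ / Λ with hr
  have hr0 : 0 < r := by positivity
  refine ⟨NNReal.mk (K * (1 / r ^ (α : ℝ) + 1) + 2 * |M| / r ^ (α : ℝ)) (by positivity),
    holderOnWith_of_norm_sub_le fun x hx y hy => ?_⟩
  rw [NNReal.coe_mk, add_mul]
  by_cases hxy : ‖x - y‖ < r
  · have hsub : ball x (Λ * r) ⊆ D := by
      rw [hr, mul_div_cancel₀ _ (by positivity)]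
      exact (ball_subset_thickening hx δ).trans hthick
    refine (hw x r hr0 hsub x (mem_ball_self hr0) y
      (by rwa [mem_ball, dist_comm, dist_eq_norm])).trans ?_
    have : 0 ≤ 2 * |M| / r ^ (α : ℝ) * ‖x - y‖ ^ (α : ℝ) := by positivity
    calc _ = K * (1 / r ^ (α : ℝ) + 1) * ‖x - y‖ ^ (α : ℝ) := by ring
      _ ≤ _ := le_add_of_nonneg_right this
  · have h1 : r ^ (α : ℝ) ≤ ‖x - y‖ ^ (α : ℝ) := by
      gcongr
      exact not_lt.1 hxy
    have h2 : ‖w x - w y‖ ≤ 2 * |M| := by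
      linarith [norm_sub_le (w x) (w y), hM x hx, hM y hy, le_abs_self M]
    calc ‖w x - w y‖ ≤ 2 * |M| := h2
      _ = 2 * |M| / r ^ (α : ℝ) * r ^ (α : ℝ) := by field_simp
      _ ≤ 2 * |M| / r ^ (α : ℝ) * ‖x - y‖ ^ (α : ℝ) := by gcongr
      _ ≤ _ := le_add_of_nonneg_left (by positivity)

end Holder

/-! ### Gluing the representatives -/

theorem mainTheorem3 {n : ℕ} (hn : 0 < n)
    {V : Type*} [NormedAddCommGroup V] [InnerProductSpace ℝ V] [FiniteDimensional ℝ V]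
    (u : EucSpace n → V) (hu : MemFracSobolev ((n : ℝ) / 2) u)
    (D : Set (EucSpace n)) (hDopen : IsOpen D) (hDbdd : Bornology.IsBounded D)
    (hDsmooth : HasSmoothBoundary D)
    (Λ K : ℝ) (hΛ : 1 ≤ Λ) (hK : 0 ≤ K) (α : ℝ≥0) (hα0 : 0 < α) (hα1 : α ≤ 1)
    (hint : InteriorHolderEstimate u D Λ K α)
    (γ : ℝ) (hγ : 0 < γ) (g : EucSpace n → V)
    (hg : ContinuousOn g (thickening γ D \ D))
    (hug : u =ᵐ[volume.restrict (thickening γ D \ D)] g) :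
    ∃ w : EucSpace n → V, w =ᵐ[volume] u ∧
      ContinuousOn w (thickening γ D) ∧
      EqOn w g (thickening γ D \ D) ∧
      (∀ (x₀ : EucSpace n) (r : ℝ), 0 < r → ball x₀ (Λ * r) ⊆ D →
        ∃ C : ℝ≥0, HolderOnWith C α w (ball x₀ r)) ∧
      (∀ S : Set (EucSpace n), IsCompact S → S ⊆ D → ∃ C : ℝ≥0, HolderOnWith C α w S) := by
  classical
  have hα0' : (0 : ℝ) < α := hα0
  set T := thickening γ D with hTdef
  have hT : IsOpen T := isOpen_thickening
  have hDT : D ⊆ T := self_subset_thickening hγ D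
  obtain ⟨w₀, hw₀, hw₀u⟩ := hint.exists_continuousOn hDopen hΛ hα0'
  have hug' : ∀ᵐ x, x ∈ T \ D → u x = g x :=
    (ae_restrict_iff' (hT.measurableSet.diff hDopen.measurableSet)).1 hug
  set w : EucSpace n → V := D.piecewise w₀ ((T \ D).piecewise g u) with hw
  have hwD : EqOn w w₀ D := fun x hx => piecewise_eq_of_mem _ _ _ hx
  have hwg : EqOn w g (T \ D) := fun x hx => by
    rw [hw, piecewise_eq_of_notMem _ _ _ hx.2, piecewise_eq_of_mem _ _ _ hx]
  have hwcont : ContinuousOn w D := hw₀.congr hwD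
  have hwuD : ∀ᵐ x, x ∈ D → w x = u x := by
    filter_upwards [hw₀u] with x hx hxD
    rw [hwD hxD, hx hxD]
  have hest : ∀ (x₀ : EucSpace n) (r : ℝ), 0 < r → ball x₀ (Λ * r) ⊆ D →
      ∀ x ∈ ball x₀ r, ∀ y ∈ ball x₀ r,
        ‖w x - w y‖ ≤ K * (‖x - y‖ ^ (α : ℝ) / r ^ (α : ℝ) + ‖x - y‖ ^ (α : ℝ)) :=
    fun x₀ r hr hball x hx y hy => hint.forall_ball hΛ hα0' hwcont hwuD hr hball hx hy
  refine ⟨w, ?_, ?_, hwg, fun x₀ r hr hball => exists_holderOnWith_ball hK hr (hest x₀ r hr hball),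
    fun S hS hSD => exists_holderOnWith_compact hDopen hΛ hK hwcont hest hS hSD⟩
  · filter_upwards [hwuD, hug'] with x hxD hxT
    by_cases h1 : x ∈ D
    · exact hxD h1
    by_cases h2 : x ∈ T \ D
    · rw [hwg h2, hxT h2]
    · rw [hw, piecewise_eq_of_notMem _ _ _ h1, piecewise_eq_of_notMem _ _ _ h2]
  · intro x hx
    by_cases hxD : x ∈ D
    · exact (hwcont.continuousAt (hDopen.mem_nhds hxD)).continuousWithinAt
    -- At a point outside `D`, approach from `T \ D` is continuity of `g`. Approach from `D` matters
    -- only on the frontier, since other points are not in `closure D`.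
    rw [← union_sdiff_cancel hDT, continuousWithinAt_union]
    have hxT : x ∈ T \ D := ⟨hx, hxD⟩
    refine ⟨?_, (hg x hxT).congr hwg (hwg hxT)⟩
    by_cases hcl : x ∈ closure D
    · have hfr : x ∈ frontier D := by
        rw [frontier, hDopen.interior_eq]
        exact ⟨hcl, hxD⟩
      rw [ContinuousWithinAt, hwg hxT]
      exact tendsto_nhdsWithin_frontier hDopen hT hDsmooth
        (fun ε hε => hu.eventually_exists_lintegral_ball_le hn hε) hΛ hK hα0' hest hwuD hug' hfr hx
        (hg x hxT)
    · exact continuousWithinAt_of_notMem_closure hcl
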